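/- Let $K$ be a commutative unital $\mathbb Q$-algebra, let $z=(z_1,\dots,z_n)$ be either commuting variables or noncommuting free variables, and let $t$ be a central parameter. Write $K\langle\langle z\rangle\rangle$ and $K[[t]]\langle\langle z\rangle\rangle$ for the algebras of formal power series in $z$ over $K$ and over $K[[t]]$. Let $\alpha\ge 1$, let $H(z)\in K\langle\langle z\rangle\rangle^{\times n}$ have order $o(H)\ge\alpha$, and let $F_t(z)=z-tH(z)$, regarded as an automorphism $u(z)\mapsto u(F_t(z))$ of $K[[t]]\langle\langle z\rangle\rangle$ over $K[[t]]$. Write its inverse map as $G_t(z)=z+M_t(z)=z+tN_t(z)$ with $N_t(z)=\sum_{m\ge 1}t^{m-1}N_{[m]}(z)$, $N_{[m]}(z)\in K\langle\langle z\rangle\rangle^{\times n}$. For a vector $u=(u_1,\dots,u_n)$ of power series let $\left[u\frac{\partial}{\partial z}\right]$ be the derivation over the base ring with $z_i\mapsto u_i$ for all $i$, and define the derivations $\psi_k$ $(k\ge1)$ of $K\langle\langle z\rangle\rangle$ by $$\sum_{k\ge 1}t^{k-1}\psi_k=\left[\frac{\partial M_t}{\partial t}(F_t)\,\frac{\partial}{\partial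 z}\right].$$ For a composition $I=(i_1,\dots,i_k)$ (a finite sequence of positive integers) put $\ell(I)=k$, $fp(I)=i_1$, $\pi_u(I)=\prod_{j=1}^{k}(i_1+\cdots+i_j)$ and $\psi^I=\psi_{i_1}\psi_{i_2}\cdots\psi_{i_k}$, and let $\mathcal C_m$ be the set of compositions with $i_1+\cdots+i_k=m$. Write $I\succcurlyeq J$ if $I$ is a refinement of $J=(j_1,\dots,j_l)$, i.e. if $I$ is the concatenation of nonempty compositions $I_1,\dots,I_l$ such that the sum of the parts of $I_a$ is $j_a$ for each $a$; in that case put $\pi_u(I,J)=\prod_{a=1}^{l}\pi_u(I_a)$. Then for every $m\ge 1$ $$N_{[m]}(z)=\sum_{I\in\mathcal C_m}c_I\,\psi^I z,\qquad\text{where}\qquad c_I=\sum_{J\,:\,I\succcurlyeq J}(-1)^{\ell(J)-1}\,\frac{fp(J)}{\pi_u(I,J)}.$$ -/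

import Mathlib

open scoped PowerSeries

noncomputable section

/-! ## Compositions -/

namespace CompositionCoeff

variable {m : ℕ}

/-- The first part `fp(I) = i₁` of a composition `I = (i₁, …, i_k)`. -/
def fp (I : Composition m) : ℕ := I.blocks.headD 0

/-- `π_u(I) = i₁ (i₁ + i₂) ⋯ (i₁ + ⋯ + i_k)`. -/
def piU (I : Composition m) : ℕ := ∏ j : Fin I.length, I.sizeUpTo (j + 1)

/-- `I ≽ J`: the composition `I` is a refinement of `J` (and `J` a coarsening of `I`), i.e. `I` can
be cut into consecutive nonempty segments whose sums are the successive parts of `J`. The cut is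
recorded by the composition `d` of `ℓ(I)` formed by the lengths of the segments. -/
def Refines (I J : Composition m) : Prop := ∃ d : Composition I.length, I.gather d = J

/-- The cut of `I` that exhibits `I ≽ J` is unique. -/
theorem gather_injective (I : Composition m) : Function.Injective I.gather := by
  intro d e h
  have key : ∀ (b : Composition I.length) (i : ℕ), i < b.length →
      I.sizeUpTo (b.sizeUpTo i) = (I.gather b).sizeUpTo i := by
    intro b i hi
    have := I.sizeUpTo_sizeUpTo_add b (i := i) (j := 0) hi (b.blocks_pos' i hi)
    simpa using this
  have hl : d.length = e.length := by
    rw [← I.length_gather d, ← I.length_gather e, h]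
  have hinj : ∀ p q : ℕ, p ≤ I.length → q ≤ I.length → I.sizeUpTo p = I.sizeUpTo q → p = q := by
    intro p q hp hq hpq
    have := I.boundary.injective (a₁ := ⟨p, by omega⟩) (a₂ := ⟨q, by omega⟩)
      (Fin.ext (by simpa [Composition.boundary] using hpq))
    simpa using this
  have hs : ∀ i, d.sizeUpTo i = e.sizeUpTo i := by
    intro i
    rcases lt_or_ge i d.length with hi | hi
    · refine hinj _ _ (d.sizeUpTo_le i) (e.sizeUpTo_le i) ?_
      rw [key d i hi, key e i (hl ▸ hi), h]
    · rw [d.sizeUpTo_ofLength_le i hi, e.sizeUpTo_ofLength_le i (hl ▸ hi)]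
  apply Composition.ext
  refine List.ext_getElem hl fun i h1 h2 => ?_
  have a1 := d.sizeUpTo_succ h1
  have a2 := e.sizeUpTo_succ h2
  rw [hs, hs, a2] at a1
  omega

/-- `π_u(I, J) = ∏ₐ π_u(Iₐ)` for `I ≽ J`, where `Iₐ` is the segment of `I` that sums to the `a`-th
part of `J`. -/
def piURel {I J : Composition m} (h : Refines I J) : ℕ :=
  ∏ a : Fin (I.gather h.choose).length, piU (I.sigmaCompositionAux h.choose a)

open scoped Classical in
/-- `c_I = ∑_{J ≼ I} (-1)^{ℓ(J) - 1} fp(J) / π_u(I, J)`, for a composition `I` of a positive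
integer. -/
def c (I : Composition m) : ℚ :=
  ∑ J : {J : Composition m // Refines I J},
    (-1 : ℚ) ^ (J.1.length - 1) * ((fp J.1 : ℚ) / (piURel J.2 : ℚ))

end CompositionCoeff

/-! ## Commuting variables

`K⟨⟨z⟩⟩` is `MvPowerSeries (Fin n) K`, and `K[[t]]⟨⟨z⟩⟩` is `MvPowerSeries (Fin n) K⟦X⟧`. -/

namespace CommSeries

variable {n : ℕ} {K : Type*} [CommRing K]

/-- The derivation `[u ∂/∂z]` over the base ring: it sends `zᵢ` to `uᵢ`. -/
def deriv (u : Fin n → MvPowerSeries (Fin n) K) :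
    Derivation K (MvPowerSeries (Fin n) K) (MvPowerSeries (Fin n) K) :=
  ∑ i, u i • MvPowerSeries.pderiv K i

theorem deriv_X (u : Fin n → MvPowerSeries (Fin n) K) (i : Fin n) :
    deriv u (MvPowerSeries.X i) = u i := by
  classical
  have h : ∀ j, (MvPowerSeries.pderiv K j) (MvPowerSeries.X i) =
      if j = i then (1 : MvPowerSeries (Fin n) K) else 0 := by
    intro j
    split_ifs with hj
    · subst hj; simp
    · simp [MvPowerSeries.pderiv_X_of_ne (Ne.symm hj)]
  have h2 : deriv u (MvPowerSeries.X i) =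
      ∑ j, u j * (MvPowerSeries.pderiv K j) (MvPowerSeries.X i) := by
    rw [deriv]
    rw [← Derivation.coeFnAddMonoidHom_apply, map_sum, Finset.sum_apply]
    rfl
  rw [h2]
  simp [h]

/-- The coefficient of `t^k` of an element of `K[[t]]⟨⟨z⟩⟩`, an element of `K⟨⟨z⟩⟩`. -/
def tCoeff (k : ℕ) (f : MvPowerSeries (Fin n) K⟦X⟧) : MvPowerSeries (Fin n) K :=
  fun a => PowerSeries.coeff k (MvPowerSeries.coeff a f)

/-- The derivative `∂/∂t` on `K[[t]]⟨⟨z⟩⟩`. -/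
def dt (f : MvPowerSeries (Fin n) K⟦X⟧) : MvPowerSeries (Fin n) K⟦X⟧ :=
  fun a => PowerSeries.derivative (R := K) (MvPowerSeries.coeff a f)

/-- The inclusion of `K⟨⟨z⟩⟩` in `K[[t]]⟨⟨z⟩⟩`. -/
def incl (f : MvPowerSeries (Fin n) K) : MvPowerSeries (Fin n) K⟦X⟧ :=
  MvPowerSeries.map (PowerSeries.C (R := K)) f

/-! An automorphism `F_t` of `K[[t]]⟨⟨z⟩⟩` over `K[[t]]` acts by `u ↦ u(F_t)`, where `F_t(z)ᵢ` is the
image of `zᵢ` (an algebra automorphism of this form is determined by these images); its inverse map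
`G_t` is `F.symm`. -/

variable (F : MvPowerSeries (Fin n) K⟦X⟧ ≃ₐ[K⟦X⟧] MvPowerSeries (Fin n) K⟦X⟧)

/-- `M_t(z)`, where `G_t(z) = z + M_t(z)` is the inverse map of `F_t`. -/
def Mt (i : Fin n) : MvPowerSeries (Fin n) K⟦X⟧ :=
  F.symm (MvPowerSeries.X i) - MvPowerSeries.X i

/-- `N_[k](z)`, where `M_t(z) = t N_t(z)` and `N_t(z) = ∑_k t^{k-1} N_[k](z)`; so it is the
coefficient of `t^k` of `M_t(z)`. -/
def N (k : ℕ) (i : Fin n) : MvPowerSeries (Fin n) K := tCoeff k (Mt F i)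

/-- The derivation `h(t) = [(∂M_t/∂t)(F_t) ∂/∂z]` of `K[[t]]⟨⟨z⟩⟩` over `K[[t]]`. -/
def h : Derivation K⟦X⟧ (MvPowerSeries (Fin n) K⟦X⟧) (MvPowerSeries (Fin n) K⟦X⟧) :=
  deriv fun i => F (dt (Mt F i))

/-- The differential operators `ψ_k` (`k ≥ 1`) on `K⟨⟨z⟩⟩` with `h(t) = ∑_{k ≥ 1} t^{k-1} ψ_k`. -/
def psi (k : ℕ) : Module.End K (MvPowerSeries (Fin n) K) where
  toFun f := tCoeff (k - 1) (h F (incl f))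
  map_add' f g := by
    have e : incl (f + g) = incl f + incl g := map_add _ _ _
    rw [e, map_add]
    funext a; exact map_add _ _ _
  map_smul' r f := by
    have e : incl (r • f) = (PowerSeries.C r : K⟦X⟧) • incl f := by
      ext a : 1
      simp [incl]
    rw [e, Derivation.map_smul]
    funext a; exact PowerSeries.coeff_C_mul _ _ _

/-- `ψ^I = ψ_{i₁} ψ_{i₂} ⋯ ψ_{i_k}` for a composition `I = (i₁, …, i_k)`. -/
def psiPow {m : ℕ} (I : Composition m) : Module.End K (MvPowerSeries (Fin n) K) :=
  (I.blocks.map (psi F)).prod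

end CommSeries

/-! ## Noncommuting free variables -/

/-- Formal power series over `R` in the noncommuting free variables `z_s`, `s : σ`: the family of
the coefficients of the words in these variables. -/
def NCPowerSeries (σ R : Type*) := List σ → R

namespace NCPowerSeries

variable {σ R : Type*} [CommRing R]

instance : AddCommGroup (NCPowerSeries σ R) := inferInstanceAs (AddCommGroup (List σ → R))

instance : Module R (NCPowerSeries σ R) := inferInstanceAs (Module R (List σ → R))

/-- The coefficient of a word. -/
def coeff (w : List σ) : NCPowerSeries σ R →ₗ[R] R := LinearMap.proj w

@[ext] theorem ext {f g : NCPowerSeries σ R} (H : ∀ w, coeff w f = coeff w g) : f = g := funext H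

/-- The constant series `r`. -/
def const (r : R) : NCPowerSeries σ R
  | [] => r
  | _ :: _ => 0

instance : One (NCPowerSeries σ R) := ⟨const 1⟩

/-- The coefficient of `w` in `f * g` is the sum of `f_a g_b` over all factorizations `w = a b`. -/
instance : Mul (NCPowerSeries σ R) :=
  ⟨fun f g w => ∑ i ∈ Finset.range (w.length + 1), coeff (w.take i) f * coeff (w.drop i) g⟩

/-- The series `∂_a f` whose coefficient at `w` is that of `z_a w` in `f`. -/
def tail (a : σ) (f : NCPowerSeries σ R) : NCPowerSeries σ R := fun w => coeff (a :: w) f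

theorem coeff_const_nil (r : R) : coeff ([] : List σ) (const r) = r := rfl

theorem coeff_const_cons (r : R) (a : σ) (w : List σ) : coeff (a :: w) (const r) = 0 := rfl

theorem coeff_mul (w : List σ) (f g : NCPowerSeries σ R) : coeff w (f * g) =
    ∑ i ∈ Finset.range (w.length + 1), coeff (w.take i) f * coeff (w.drop i) g := rfl

theorem coeff_tail (a : σ) (w : List σ) (f : NCPowerSeries σ R) :
    coeff w (tail a f) = coeff (a :: w) f := rfl

theorem coeff_mul_nil (f g : NCPowerSeries σ R) :
    coeff [] (f * g) = coeff [] f * coeff [] g := by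
  simp [coeff_mul]

theorem coeff_mul_cons (a : σ) (w : List σ) (f g : NCPowerSeries σ R) :
    coeff (a :: w) (f * g) = coeff [] f * coeff (a :: w) g + coeff w (tail a f * g) := by
  rw [coeff_mul, coeff_mul, List.length_cons, Finset.sum_range_succ', add_comm]
  simp [coeff_tail]

theorem coeff_mul_add (w : List σ) (f g k : NCPowerSeries σ R) :
    coeff w (f * (g + k)) = coeff w (f * g) + coeff w (f * k) := by
  simp [coeff_mul, mul_add, Finset.sum_add_distrib]

theorem coeff_add_mul (w : List σ) (f g k : NCPowerSeries σ R) :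
    coeff w ((f + g) * k) = coeff w (f * k) + coeff w (g * k) := by
  simp [coeff_mul, add_mul, Finset.sum_add_distrib]

theorem coeff_smul_mul (w : List σ) (r : R) (f g : NCPowerSeries σ R) :
    coeff w ((r • f) * g) = r * coeff w (f * g) := by
  simp [coeff_mul, Finset.mul_sum, mul_assoc]

theorem tail_mul (a : σ) (f g : NCPowerSeries σ R) :
    tail a (f * g) = coeff [] f • tail a g + tail a f * g := by
  ext w
  simp [coeff_tail, coeff_mul_cons]

theorem coeff_const_mul (r : R) (w : List σ) (f : NCPowerSeries σ R) :
    coeff w (const r * f) = r * coeff w f := by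
  cases w with
  | nil => rw [coeff_mul_nil, coeff_const_nil]
  | cons a w =>
    have : tail a (const r : NCPowerSeries σ R) = 0 := rfl
    rw [coeff_mul_cons, coeff_const_nil, this]
    simp [coeff_mul]

theorem coeff_mul_const (r : R) (w : List σ) (f : NCPowerSeries σ R) :
    coeff w (f * const r) = coeff w f * r := by
  induction w generalizing f with
  | nil => rw [coeff_mul_nil, coeff_const_nil]
  | cons a w ih => rw [coeff_mul_cons, coeff_const_cons, ih, coeff_tail, mul_zero, zero_add]

theorem coeff_mul_assoc (w : List σ) (f g k : NCPowerSeries σ R) :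
    coeff w (f * g * k) = coeff w (f * (g * k)) := by
  induction w generalizing f with
  | nil => simp only [coeff_mul_nil, mul_assoc]
  | cons a w ih =>
    simp only [coeff_mul_cons, coeff_mul_nil, tail_mul, coeff_add_mul, coeff_smul_mul, ih]
    ring

instance : Ring (NCPowerSeries σ R) where
  __ := (inferInstance : AddCommGroup (NCPowerSeries σ R))
  left_distrib f g k := by ext w; simp [coeff_mul_add]
  right_distrib f g k := by ext w; simp [coeff_add_mul]
  zero_mul f := by ext w; simp [coeff_mul]
  mul_zero f := by ext w; simp [coeff_mul]
  mul_assoc f g k := by ext w; exact coeff_mul_assoc w f g k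
  one_mul f := by ext w; exact (coeff_const_mul 1 w f).trans (one_mul _)
  mul_one f := by ext w; exact (coeff_mul_const 1 w f).trans (mul_one _)

instance : Algebra R (NCPowerSeries σ R) where
  algebraMap :=
    { toFun := const
      map_one' := rfl
      map_mul' := by
        intro r s
        ext w
        rw [coeff_const_mul]
        cases w <;> simp [coeff_const_nil, coeff_const_cons]
      map_zero' := by ext w; cases w <;> rfl
      map_add' := by
        intro r s
        ext w
        rw [map_add]
        cases w <;> simp [coeff_const_nil, coeff_const_cons] }
  commutes' := by
    intro r f
    ext w
    change coeff w (const r * f) = coeff w (f * const r)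
    rw [coeff_const_mul, coeff_mul_const, mul_comm]
  smul_def' := by
    intro r f
    ext w
    exact (coeff_const_mul r w f).symm

/-- The variable `z_s`. -/
def X [DecidableEq σ] (s : σ) : NCPowerSeries σ R := fun w => if w = [s] then 1 else 0

/-- The derivation `[u ∂/∂z]` over the base ring, which sends `zᵢ` to `uᵢ`: for a word `w` it
replaces in turn each letter `zᵢ` of `w` by `uᵢ`, and adds up. So the coefficient of `w` is the sum
of `f_{a zᵢ b} (uᵢ)_v` over all variables `zᵢ` and all factorizations `w = a v b`. -/
def deriv {n : ℕ} (u : Fin n → NCPowerSeries (Fin n) R) :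
    NCPowerSeries (Fin n) R →ₗ[R] NCPowerSeries (Fin n) R where
  toFun f := fun w => ∑ p ∈ Finset.range (w.length + 1), ∑ q ∈ Finset.range (w.length - p + 1),
    ∑ i, coeff (w.take p ++ i :: (w.drop p).drop q) f * coeff ((w.drop p).take q) (u i)
  map_add' f g := by
    funext w
    simp only [map_add, add_mul, Finset.sum_add_distrib]
    rfl
  map_smul' r f := by
    funext w
    simp only [map_smul, smul_eq_mul, mul_assoc, ← Finset.mul_sum]
    rfl

theorem coeff_deriv {n : ℕ} (u : Fin n → NCPowerSeries (Fin n) R) (f : NCPowerSeries (Fin n) R)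
    (w : List (Fin n)) : coeff w (deriv u f) =
      ∑ p ∈ Finset.range (w.length + 1), ∑ q ∈ Finset.range (w.length - p + 1),
        ∑ i, coeff (w.take p ++ i :: (w.drop p).drop q) f * coeff ((w.drop p).take q) (u i) := rfl

theorem coeff_X [DecidableEq σ] (s : σ) (w : List σ) :
    coeff w (X s : NCPowerSeries σ R) = if w = [s] then 1 else 0 := rfl

theorem coeff_deriv_nil {n : ℕ} (u : Fin n → NCPowerSeries (Fin n) R)
    (f : NCPowerSeries (Fin n) R) :
    coeff [] (deriv u f) = ∑ i, coeff [] (u i * tail i f) := by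
  simp [coeff_deriv, coeff_mul_nil, coeff_tail, mul_comm]

theorem coeff_deriv_cons {n : ℕ} (u : Fin n → NCPowerSeries (Fin n) R)
    (f : NCPowerSeries (Fin n) R) (a : Fin n) (w : List (Fin n)) :
    coeff (a :: w) (deriv u f) =
      ∑ i, coeff (a :: w) (u i * tail i f) + coeff w (deriv u (tail a f)) := by
  rw [coeff_deriv, coeff_deriv, List.length_cons, Finset.sum_range_succ', add_comm]
  congr 1
  · simp only [coeff_mul, coeff_tail]
    rw [Finset.sum_comm]
    simp [mul_comm]
  · simp [coeff_tail]

theorem deriv_X {n : ℕ} (u : Fin n → NCPowerSeries (Fin n) R) (i : Fin n) :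
    deriv u (X i) = u i := by
  have ht : ∀ j, tail j (X i : NCPowerSeries (Fin n) R) = if j = i then 1 else 0 := by
    intro j
    ext w
    rw [coeff_tail, coeff_X]
    by_cases hj : j = i
    · subst hj
      cases w with
      | nil => simp only [if_true]; rfl
      | cons b w => simp only [if_true]; simp; rfl
    · simp [hj]
  have hs : ∀ w, ∑ j, coeff w (u j * tail j (X i : NCPowerSeries (Fin n) R)) = coeff w (u i) := by
    intro w
    rw [Finset.sum_eq_single i]
    · simp [ht]
    · intro j _ hj
      simp [ht, hj]
    · simp
  ext w
  cases w with
  | nil => rw [coeff_deriv_nil, hs]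
  | cons a w =>
    rw [coeff_deriv_cons, hs, ht, add_eq_left]
    split_ifs
    · have h1 : ∀ j : Fin n, tail j (1 : NCPowerSeries (Fin n) R) = 0 := fun j => rfl
      cases w <;> simp [coeff_deriv_nil, coeff_deriv_cons, h1]
    · simp

/-- The Leibniz rule. -/
theorem deriv_mul {n : ℕ} (u : Fin n → NCPowerSeries (Fin n) R) (f g : NCPowerSeries (Fin n) R) :
    deriv u (f * g) = deriv u f * g + f * deriv u g := by
  ext w
  induction w generalizing f with
  | nil =>
    simp only [map_add, coeff_mul_nil, coeff_deriv_nil, tail_mul, map_smul, smul_eq_mul,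
      Finset.sum_mul, Finset.mul_sum, ← Finset.sum_add_distrib]
    refine Finset.sum_congr rfl fun i _ => ?_
    ring
  | cons a w ih =>
    have htail : tail a (deriv u f) = ∑ i, tail a (u i * tail i f) + deriv u (tail a f) := by
      ext v
      simp only [coeff_tail, coeff_deriv_cons, map_add, map_sum]
    have h1 : ∀ i, coeff (a :: w) (u i * tail i (f * g)) =
        coeff [] f * coeff (a :: w) (u i * tail i g) +
          (coeff [] (u i * tail i f) * coeff (a :: w) g +
            coeff w (tail a (u i * tail i f) * g)) := by
      intro i
      rw [tail_mul, mul_add, map_add, mul_smul_comm, map_smul, smul_eq_mul, ← mul_assoc,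
        coeff_mul_cons _ _ (u i * tail i f)]
    rw [coeff_deriv_cons, map_add, coeff_mul_cons, coeff_mul_cons, htail, coeff_deriv_cons,
      coeff_deriv_nil, tail_mul, map_add, map_add, ih, map_smul (deriv u)]
    simp only [h1, Finset.sum_add_distrib, add_mul, map_add, Finset.sum_mul, map_sum, mul_add,
      Finset.mul_sum, map_smul, smul_eq_mul]
    ring

end NCPowerSeries

namespace NCSeries

/-! `K⟨⟨z⟩⟩` is `NCPowerSeries (Fin n) K`, and `K[[t]]⟨⟨z⟩⟩` is `NCPowerSeries (Fin n) K⟦X⟧`. -/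

variable {n : ℕ} {K : Type*} [CommRing K]

/-- The coefficient of `t^k` of an element of `K[[t]]⟨⟨z⟩⟩`, an element of `K⟨⟨z⟩⟩`. -/
def tCoeff (k : ℕ) (f : NCPowerSeries (Fin n) K⟦X⟧) : NCPowerSeries (Fin n) K :=
  fun w => PowerSeries.coeff k (NCPowerSeries.coeff w f)

/-- The derivative `∂/∂t` on `K[[t]]⟨⟨z⟩⟩`. -/
def dt (f : NCPowerSeries (Fin n) K⟦X⟧) : NCPowerSeries (Fin n) K⟦X⟧ :=
  fun w => PowerSeries.derivative (R := K) (NCPowerSeries.coeff w f)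

/-- The inclusion of `K⟨⟨z⟩⟩` in `K[[t]]⟨⟨z⟩⟩`. -/
def incl (f : NCPowerSeries (Fin n) K) : NCPowerSeries (Fin n) K⟦X⟧ :=
  fun w => PowerSeries.C (NCPowerSeries.coeff w f)

/-- `α ≤ o(f)`: only words of length at least `α` occur in `f`. -/
def LeOrder (α : ℕ) (f : NCPowerSeries (Fin n) K) : Prop :=
  ∀ w : List (Fin n), w.length < α → NCPowerSeries.coeff w f = 0

variable (F : NCPowerSeries (Fin n) K⟦X⟧ ≃ₐ[K⟦X⟧] NCPowerSeries (Fin n) K⟦X⟧)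

/-- `M_t(z)`, where `G_t(z) = z + M_t(z)` is the inverse map of `F_t`. -/
def Mt (i : Fin n) : NCPowerSeries (Fin n) K⟦X⟧ :=
  F.symm (NCPowerSeries.X i) - NCPowerSeries.X i

/-- `N_[k](z)`, where `M_t(z) = t N_t(z)` and `N_t(z) = ∑_k t^{k-1} N_[k](z)`; so it is the
coefficient of `t^k` of `M_t(z)`. -/
def N (k : ℕ) (i : Fin n) : NCPowerSeries (Fin n) K := tCoeff k (Mt F i)

/-- The derivation `h(t) = [(∂M_t/∂t)(F_t) ∂/∂z]` of `K[[t]]⟨⟨z⟩⟩` over `K[[t]]`. -/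
def h : NCPowerSeries (Fin n) K⟦X⟧ →ₗ[K⟦X⟧] NCPowerSeries (Fin n) K⟦X⟧ :=
  NCPowerSeries.deriv fun i => F (dt (Mt F i))

/-- The differential operators `ψ_k` (`k ≥ 1`) on `K⟨⟨z⟩⟩` with `h(t) = ∑_{k ≥ 1} t^{k-1} ψ_k`. -/
def psi (k : ℕ) : Module.End K (NCPowerSeries (Fin n) K) where
  toFun f := tCoeff (k - 1) (h F (incl f))
  map_add' f g := by
    have e : incl (f + g) = incl f + incl g := by
      funext w; exact map_add _ _ _
    rw [e, map_add]
    funext w; exact map_add _ _ _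
  map_smul' r f := by
    have e : incl (r • f) = (PowerSeries.C r : K⟦X⟧) • incl f := by
      funext w; exact map_mul _ _ _
    rw [e, map_smul]
    funext w; exact PowerSeries.coeff_C_mul _ _ _

/-- `ψ^I = ψ_{i₁} ψ_{i₂} ⋯ ψ_{i_k}` for a composition `I = (i₁, …, i_k)`. -/
def psiPow {m : ℕ} (I : Composition m) : Module.End K (NCPowerSeries (Fin n) K) :=
  (I.blocks.map (psi F)).prod

end NCSeries

end

/-! Regard `F` and its inverse as series $\sum t^k f_k$ and $\sum t^k g_k$ whose coefficients are
operators on $K\langle\langle z\rangle\rangle$; write $G$ for the second. The operator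
$F\circ\partial_t\circ F^{-1}-\partial_t$ is a $K[[t]]$-linear derivation with value $(\partial
M_t/\partial t)(F_t)$ at $z$, so it is $h(t)$ (`h_eq_conjDt`). On series free of $t$ this reads
$\partial_t G=G\,h(t)$, that is $(n+1)g_{n+1}=\sum_k g_{n-k}\psi_{k+1}$. Since $f_0=1$, also
$g_0=1$.

The recursion gives $g_m=\sum_I\psi^I/\pi_u(I)$ (`eq_sum_composition_of_recursion`), and inverting
$G$ gives $f_m=\sum_J(-1)^{\ell(J)}g^J$ (`eq_sum_composition_of_inverse`). Expanding every factor of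
$g^J$ produces all refinements $I$ of $J$ with weight $1/\pi_u(I,J)$. Hence $\sum_I
c_I\psi^I=\sum_J(-1)^{\ell(J)-1}fp(J)\,g^J$, which is the coefficient of $t^m$ in $t\,G'F$
(`sum_c_smul`).

Apply this to $z$. As $F(z)=z-tH$, only $f_0z=z$ and $f_1z=-H$ survive, leaving
$m\,g_mz-(m-1)g_{m-1}H$. The identity $GF=1$ at $z$ gives $g_mz=g_{m-1}H$, so the value is
$g_mz=N_{[m]}$ (`coeff_symm_eq_sum`). -/

noncomputable section

open Finset

open scoped PowerSeries

/-! ### Sums over compositions. -/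

namespace CompositionCoeff

section Recursion

variable {M : Type*} [AddCommMonoid M]

/-- Splitting off the first part of a composition. -/
theorem sum_composition_succ_cons (f : List ℕ → M) (n : ℕ) :
    ∑ I : Composition (n + 1), f I.blocks =
      ∑ p ∈ antidiagonal n, ∑ J : Composition p.2, f ((p.1 + 1) :: J.blocks) := by
  rw [Finset.sum_sigma']
  symm
  refine Finset.sum_bij
    (fun x hx => ⟨(x.1.1 + 1) :: x.2.blocks, ?_, ?_⟩) ?_ ?_ ?_ ?_
  · intro i hi
    rcases List.mem_cons.1 hi with rfl | hi
    · omega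
    · exact x.2.blocks_pos hi
  · have := mem_antidiagonal.1 (mem_sigma.1 hx).1
    rw [List.sum_cons, x.2.blocks_sum]
    omega
  · intros; exact mem_univ _
  · rintro ⟨⟨a, b⟩, J⟩ h ⟨⟨a', b'⟩, J'⟩ h' e
    simp only [Composition.mk.injEq, List.cons.injEq, add_left_inj] at e
    obtain ⟨rfl, e⟩ := e
    have h1 := mem_antidiagonal.1 (mem_sigma.1 h).1
    have h2 := mem_antidiagonal.1 (mem_sigma.1 h').1
    simp only at h1 h2
    obtain rfl : b = b' := by omega
    obtain rfl : J = J' := Composition.ext e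
    rfl
  · intro I _
    obtain ⟨L, hpos, hsum⟩ := I
    cases L with
    | nil => simp at hsum
    | cons k L =>
      have hk : 0 < k := hpos List.mem_cons_self
      rw [List.sum_cons] at hsum
      refine ⟨⟨(k - 1, L.sum), ⟨L, fun hi => hpos (List.mem_cons_of_mem _ hi), rfl⟩⟩, ?_, ?_⟩
      · refine mem_sigma.2 ⟨HasAntidiagonal.mem_antidiagonal.2 ?_, mem_univ _⟩
        simp only
        omega
      · apply Composition.ext
        simp only [List.cons.injEq, and_true]
        omega
  · intros; rfl

/-- Splitting off the last part of a composition. -/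
theorem sum_composition_succ_append (f : List ℕ → M) (n : ℕ) :
    ∑ I : Composition (n + 1), f I.blocks =
      ∑ p ∈ antidiagonal n, ∑ J : Composition p.2, f (J.blocks ++ [p.1 + 1]) := by
  have key : ∀ (m : ℕ) (g : List ℕ → M),
      ∑ I : Composition m, g I.blocks = ∑ I : Composition m, g I.blocks.reverse := fun m g =>
    (Function.Bijective.sum_comp (Composition.reverse_bijective (n := m))
      fun I => g I.blocks).symm
  -- Reversal permutes the compositions of a given integer and exchanges the first part with the
  -- last.
  rw [key, sum_composition_succ_cons fun L => f L.reverse]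
  refine Finset.sum_congr rfl fun p _ => ?_
  rw [key p.2 fun L => f (L ++ [p.1 + 1])]
  simp

theorem sum_composition_zero (f : List ℕ → M) : ∑ I : Composition 0, f I.blocks = f [] := by
  rw [Fintype.sum_eq_single (Composition.ones 0)]
  · rfl
  · intro I hI
    refine (hI (Composition.ext ?_)).elim
    exact List.length_eq_zero_iff.1 (Nat.le_zero.1 I.length_le)

end Recursion

/-- The product of the partial sums of a list. -/
def partialSumProd (L : List ℕ) : ℕ := ∏ j ∈ range L.length, (L.take (j + 1)).sum

theorem piU_eq_partialSumProd {m : ℕ} (I : Composition m) : piU I = partialSumProd I.blocks :=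
  Fin.prod_univ_eq_prod_range (fun j => I.sizeUpTo (j + 1)) I.length

theorem partialSumProd_append_singleton (L : List ℕ) (k : ℕ) :
    partialSumProd (L ++ [k]) = partialSumProd L * (L.sum + k) := by
  rw [partialSumProd, List.length_append, List.length_singleton, prod_range_succ]
  congr 1
  · refine prod_congr rfl fun j hj => ?_
    rw [List.take_append_of_le_length (by have := mem_range.1 hj; omega)]
  · rw [List.take_of_length_le (by simp)]
    simp

/-- Cutting a word into consecutive segments does not change its product; no commutativity is
involved. -/
theorem prod_map_eq_prod_cut {E : Type*} [Monoid E] (ψ : ℕ → E) {m : ℕ} (I : Composition m) (d : Composition I.length) :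
    (I.blocks.map ψ).prod =
      (List.ofFn fun a => ((I.sigmaCompositionAux d a).blocks.map ψ).prod).prod := by
  have h := congrArg (fun x => x.1.blocks)
    ((Composition.sigmaEquivSigmaPi m).symm_apply_apply ⟨I, d⟩)
  change (List.ofFn fun a => (I.sigmaCompositionAux d a).blocks).flatten = I.blocks at h
  conv_lhs => rw [← h]
  rw [List.map_flatten, List.prod_flatten, List.map_ofFn, List.map_ofFn]
  rfl

/-! ### Inverse series and differential recursion over a noncommutative ring. -/

section Algebra

variable {E : Type*} [Ring E] [Algebra ℚ E]

/-- The solution of `t G' = G ψ`, `G(0) = 1`. -/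
theorem eq_sum_composition_of_recursion {G ψ : ℕ → E} (h0 : G 0 = 1)
    (hG : ∀ n, ((n + 1 : ℕ) : ℚ) • G (n + 1) = ∑ p ∈ antidiagonal n, G p.2 * ψ (p.1 + 1))
    (m : ℕ) : G m = ∑ I : Composition m, (piU I : ℚ)⁻¹ • (I.blocks.map ψ).prod := by
  simp only [piU_eq_partialSumProd]
  induction m using Nat.strong_induction_on with
  | _ m ih =>
    cases m with
    | zero =>
      rw [sum_composition_zero fun L => (partialSumProd L : ℚ)⁻¹ • (L.map ψ).prod]
      simp [h0, partialSumProd]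
    | succ n =>
      rw [sum_composition_succ_append fun L => (partialSumProd L : ℚ)⁻¹ • (L.map ψ).prod]
      have hn : ((n + 1 : ℕ) : ℚ) ≠ 0 := by positivity
      rw [← inv_smul_smul₀ hn (G (n + 1)), hG, smul_sum]
      refine sum_congr rfl fun p hp => ?_
      have hp := mem_antidiagonal.1 hp
      rw [ih p.2 (by omega), sum_mul, smul_sum]
      refine sum_congr rfl fun J _ => ?_
      -- The last partial sum of a composition is its total $n+1$, so the division by $n+1$ in the
      -- recursion supplies exactly the new factor of $\pi_u$.
      have e : J.blocks.sum + (p.1 + 1) = n + 1 := by rw [J.blocks_sum]; omega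
      rw [partialSumProd_append_singleton, e, List.map_append, List.prod_append, smul_mul_assoc,
        smul_smul, Nat.cast_mul, mul_inv, mul_comm]
      simp

/-- The inverse of the power series `G`. -/
theorem eq_sum_composition_of_inverse {G F : ℕ → E} (h0 : G 0 = 1) (hF0 : F 0 = 1)
    (hGF : ∀ n, ∑ p ∈ antidiagonal (n + 1), G p.1 * F p.2 = 0) (m : ℕ) :
    F m = ∑ J : Composition m, (-1 : ℚ) ^ J.length • (J.blocks.map G).prod := by
  let f : List ℕ → E := fun L => (-1 : ℚ) ^ L.length • (L.map G).prod
  change F m = ∑ J : Composition m, f J.blocks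
  induction m using Nat.strong_induction_on with
  | _ m ih =>
    cases m with
    | zero =>
      rw [sum_composition_zero]
      simp [f, hF0]
    | succ n =>
      rw [sum_composition_succ_cons]
      -- With $G_0=1$ this solves for $F_{n+1}=-\sum_p G_{p+1}F_{n-p}$: each additional first part
      -- costs one sign.
      have h := hGF n
      rw [Nat.sum_antidiagonal_succ, h0, one_mul] at h
      rw [eq_neg_of_add_eq_zero_left h, ← sum_neg_distrib]
      refine sum_congr rfl fun p hp => ?_
      have hp := mem_antidiagonal.1 hp
      rw [ih p.2 (by omega), mul_sum, ← sum_neg_distrib]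
      refine sum_congr rfl fun J _ => ?_
      simp [f, pow_succ]

/-- The coefficient of `t^(n+1)` in `t G' F`, where `F = G⁻¹`. -/
theorem sum_composition_fp {G F : ℕ → E}
    (hF : ∀ m, F m = ∑ J : Composition m, (-1 : ℚ) ^ J.length • (J.blocks.map G).prod) (n : ℕ) :
    ∑ J : Composition (n + 1), ((-1 : ℚ) ^ (J.length - 1) * fp J) • (J.blocks.map G).prod =
      ∑ p ∈ antidiagonal n, ((p.1 + 1 : ℕ) : ℚ) • (G (p.1 + 1) * F p.2) := by
  let f : List ℕ → E := fun L => ((-1 : ℚ) ^ (L.length - 1) * (L.headD 0 : ℕ)) • (L.map G).prod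
  change ∑ J : Composition (n + 1), f J.blocks = _
  rw [sum_composition_succ_cons]
  refine sum_congr rfl fun p _ => ?_
  rw [hF, mul_sum, smul_sum]
  refine sum_congr rfl fun J _ => ?_
  -- With the first part $p+1$ removed, $\ell-1$ is the length of the rest, so the sign is the one
  -- in the expansion of $F$.
  simp [f, smul_smul, mul_comm]

/-- The cuts of `I` are its coarsenings. -/
def cutEquiv {m : ℕ} (I : Composition m) :
    Composition I.length ≃ {J : Composition m // Refines I J} :=
  Equiv.ofBijective (fun d => ⟨I.gather d, d, rfl⟩)
    ⟨fun _ _ h => gather_injective I (congrArg Subtype.val h),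
      fun ⟨_, d, hd⟩ => ⟨d, Subtype.ext hd⟩⟩

/-- Cuts form an index set independent of any choice, and pairs (composition, cut) can be regrouped
by coarsening. -/
theorem c_eq_sum_cut {m : ℕ} (I : Composition m) :
    c I = ∑ d : Composition I.length, (-1 : ℚ) ^ ((I.gather d).length - 1) *
      (fp (I.gather d) / ∏ a, (piU (I.sigmaCompositionAux d a) : ℚ)) := by
  classical
  rw [c]
  symm
  refine Fintype.sum_equiv (cutEquiv I) _ _ fun d => ?_
  change _ = (-1 : ℚ) ^ ((I.gather d).length - 1) * ((fp (I.gather d) : ℚ) / _)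
  congr 2
  -- The index type of the product depends on the cut, so the chosen cut is replaced by `d` through
  -- a variable equal to it; uniqueness of the cut gives the equality.
  have key : ∀ e, e = d → ∏ a, (piU (I.sigmaCompositionAux d a) : ℚ) =
      ((∏ a, piU (I.sigmaCompositionAux e a) : ℕ) : ℚ) := by
    rintro _ rfl
    push_cast
    rfl
  exact key _ (gather_injective I (cutEquiv I d).2.choose_spec)

/-- Substituting the expansions of the `G_j` in a product `G^J`. -/
theorem prod_map_sum_composition {G ψ : ℕ → E}
    (hG : ∀ m, G m = ∑ I : Composition m, (piU I : ℚ)⁻¹ • (I.blocks.map ψ).prod)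
    {m : ℕ} (J : Composition m) :
    (J.blocks.map G).prod = ∑ r : (∀ a : Fin J.length, Composition (J.blocksFun a)),
      (∏ a, (piU (r a) : ℚ))⁻¹ • (List.ofFn fun a => ((r a).blocks.map ψ).prod).prod := by
  have h1 : J.blocks.map G = List.ofFn fun a => G (J.blocksFun a) := by
    rw [← J.ofFn_blocksFun, List.map_ofFn]
    rfl
  rw [h1]
  simp only [hG]
  rw [← MultilinearMap.mkPiAlgebraFin_apply (R := ℚ), MultilinearMap.map_sum]
  refine sum_congr rfl fun r _ => ?_
  rw [MultilinearMap.map_smul_univ, MultilinearMap.mkPiAlgebraFin_apply, prod_inv_distrib]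

/-- Sums weighted by `c`, in terms of the power series `G` and `F = G⁻¹`. -/
theorem sum_c_smul {G F ψ : ℕ → E} (h0 : G 0 = 1) (hF0 : F 0 = 1)
    (hG : ∀ n, ((n + 1 : ℕ) : ℚ) • G (n + 1) = ∑ p ∈ antidiagonal n, G p.2 * ψ (p.1 + 1))
    (hGF : ∀ n, ∑ p ∈ antidiagonal (n + 1), G p.1 * F p.2 = 0) (n : ℕ) :
    ∑ I : Composition (n + 1), c I • (I.blocks.map ψ).prod =
      ∑ p ∈ antidiagonal n, ((p.1 + 1 : ℕ) : ℚ) • (G (p.1 + 1) * F p.2) := by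
  rw [← sum_composition_fp (eq_sum_composition_of_inverse h0 hF0 hGF)]
  simp only [prod_map_sum_composition (eq_sum_composition_of_recursion h0 hG), smul_sum,
    c_eq_sum_cut, sum_smul]
  rw [← Fintype.sum_sigma', ← Fintype.sum_sigma']
  -- Exchange of the two sums: a composition $I$ with a cut amounts to its coarsening $J$ with a
  -- composition of each part of $J$.
  refine Fintype.sum_equiv (Composition.sigmaEquivSigmaPi (n + 1)) _ _ fun x => ?_
  rw [prod_map_eq_prod_cut ψ x.1 x.2, smul_smul, div_eq_mul_inv, mul_assoc]
  rfl

end Algebra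

end CompositionCoeff

/-! ### Operators on power series in a central parameter, for both kinds of variables at once. -/

/-- A presentation of the `K⟦X⟧`-algebra `A` as the algebra of formal power series in a central
parameter `X` over the `K`-algebra `A₀`. -/
structure ParameterAlgebra (K A₀ A : Type*) [CommRing K] [Ring A₀] [Algebra K A₀] [Ring A]
    [Algebra K⟦X⟧ A] where
  /-- The coefficient of a power of the parameter. -/
  coeff : ℕ → A →+ A₀
  /-- The inclusion of the constant series. -/
  incl : A₀ →+* A
  /-- The derivative with respect to the parameter. -/
  dt : A →+ A
  ext : ∀ {x y : A}, (∀ k, coeff k x = coeff k y) → x = y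
  coeff_zero_incl : ∀ a, coeff 0 (incl a) = a
  coeff_succ_incl : ∀ k a, coeff (k + 1) (incl a) = 0
  incl_smul : ∀ (r : K) a, incl (r • a) = (PowerSeries.C r : K⟦X⟧) • incl a
  coeff_C_smul : ∀ k (r : K) x, coeff k ((PowerSeries.C r : K⟦X⟧) • x) = r • coeff k x
  coeff_zero_X_smul : ∀ x, coeff 0 ((PowerSeries.X : K⟦X⟧) • x) = 0
  coeff_succ_X_smul : ∀ k x, coeff (k + 1) ((PowerSeries.X : K⟦X⟧) • x) = coeff k x
  exists_eq_add : ∀ x, ∃ y, x = incl (coeff 0 x) + (PowerSeries.X : K⟦X⟧) • y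
  coeff_zero_mul : ∀ x y, coeff 0 (x * y) = coeff 0 x * coeff 0 y
  coeff_dt : ∀ k x, coeff k (dt x) = (k + 1) • coeff (k + 1) x
  dt_mul : ∀ x y, dt (x * y) = dt x * y + x * dt y
  dt_smul : ∀ (r : K⟦X⟧) x, dt (r • x) = PowerSeries.derivative (R := K) r • x + r • dt x

namespace ParameterAlgebra

variable {K A₀ A : Type*} [CommRing K] [Ring A₀] [Algebra K A₀] [Ring A] [Algebra K⟦X⟧ A]
  (S : ParameterAlgebra K A₀ A)

theorem dt_incl (a : A₀) : S.dt (S.incl a) = 0 :=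
  S.ext fun k => by rw [S.coeff_dt, S.coeff_succ_incl, smul_zero, map_zero]

/-- The coefficients of a `K⟦X⟧`-linear operator. -/
def opCoeff (f : A →ₗ[K⟦X⟧] A) (k : ℕ) : Module.End K A₀ where
  toFun a := S.coeff k (f (S.incl a))
  map_add' a b := by rw [map_add, map_add, map_add]
  map_smul' r a := by rw [S.incl_smul, map_smul, S.coeff_C_smul]; rfl

theorem opCoeff_apply (f : A →ₗ[K⟦X⟧] A) (k : ℕ) (a : A₀) :
    S.opCoeff f k a = S.coeff k (f (S.incl a)) := rfl

/-- No $t$-adic continuity is needed: writing $x=x_0+ty$ and using linearity over $K[[t]]$, the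
coefficient of $t^m$ is reached after finitely many steps. -/
theorem coeff_map (f : A →ₗ[K⟦X⟧] A) (m : ℕ) (x : A) :
    S.coeff m (f x) = ∑ p ∈ antidiagonal m, S.opCoeff f p.1 (S.coeff p.2 x) := by
  induction m generalizing x with
  | zero =>
    obtain ⟨y, hy⟩ := S.exists_eq_add x
    conv_lhs => rw [hy]
    simp [opCoeff_apply, S.coeff_zero_X_smul]
  | succ m ih =>
    obtain ⟨y, hy⟩ := S.exists_eq_add x
    have hc : ∀ j, S.coeff (j + 1) x = S.coeff j y := fun j => by
      conv_lhs => rw [hy]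
      rw [map_add, S.coeff_succ_incl, S.coeff_succ_X_smul, zero_add]
    rw [Nat.sum_antidiagonal_succ']
    conv_lhs => rw [hy]
    simp only [hc]
    rw [map_add, map_add, map_smul, S.coeff_succ_X_smul, ih, opCoeff_apply, add_comm]

theorem opCoeff_comp (f g : A →ₗ[K⟦X⟧] A) (m : ℕ) :
    S.opCoeff (f ∘ₗ g) m = ∑ p ∈ antidiagonal m, S.opCoeff f p.1 * S.opCoeff g p.2 := by
  ext a
  rw [LinearMap.sum_apply]
  exact S.coeff_map f m (g (S.incl a))

theorem opCoeff_id_zero : S.opCoeff LinearMap.id 0 = 1 :=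
  LinearMap.ext fun a => S.coeff_zero_incl a

theorem opCoeff_id_succ (m : ℕ) : S.opCoeff LinearMap.id (m + 1) = 0 :=
  LinearMap.ext fun a => S.coeff_succ_incl m a

section Automorphism

variable (F : A ≃ₐ[K⟦X⟧] A)

/-- The constant term of an automorphism. -/
def constHom : A₀ →ₐ[K] A₀ :=
  AlgHom.ofLinearMap (S.opCoeff F.toLinearMap 0)
    (by
      rw [opCoeff_apply, map_one, AlgEquiv.toLinearMap_apply, map_one, ← map_one S.incl,
        S.coeff_zero_incl])
    (fun a b => by simp [opCoeff_apply, S.coeff_zero_mul])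

/-- The derivation `F ∘ d/dt ∘ F⁻¹ - d/dt`, which is linear over the power series in `t`. -/
def conjDt : A →ₗ[K⟦X⟧] A where
  toFun x := F (S.dt (F.symm x)) - S.dt x
  map_add' x y := by simp only [map_add]; abel
  map_smul' r x := by
    -- The terms $r'x$ coming from $\partial_t(rx)=r'x+r\,\partial_tx$ cancel, because `F` fixes
    -- $K[[t]]$.
    simp only [map_smul, S.dt_smul, map_add, AlgEquiv.apply_symm_apply, RingHom.id_apply, smul_sub]
    abel

theorem conjDt_apply (x : A) : S.conjDt F x = F (S.dt (F.symm x)) - S.dt x := rfl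

theorem conjDt_mul (x y : A) :
    S.conjDt F (x * y) = S.conjDt F x * y + x * S.conjDt F y := by
  simp only [conjDt_apply, map_mul, S.dt_mul, map_add, AlgEquiv.apply_symm_apply]
  noncomm_ring

variable {F}

/-- The common core of both cases: only the image of the single element `z` must be linear in $t$,
while `constHom F = id` makes the operator series start with $1$. -/
theorem coeff_symm_eq_sum [Algebra ℚ K] (hF : S.constHom F = AlgHom.id K A₀)
    {h : A →ₗ[K⟦X⟧] A} (hh : ∀ x, h x = S.conjDt F x)
    {ψ : ℕ → Module.End K A₀} (hψ : ∀ k a, ψ k a = S.coeff (k - 1) (h (S.incl a)))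
    {z H : A₀} (hz : F (S.incl z) = S.incl z - (PowerSeries.X : K⟦X⟧) • S.incl H)
    {m : ℕ} (hm : 1 ≤ m) :
    S.coeff m (F.symm (S.incl z)) = ∑ I : Composition m,
      algebraMap ℚ K (CompositionCoeff.c I) • (I.blocks.map ψ).prod z := by
  let _ : Algebra ℚ (Module.End K A₀) := Algebra.compHom _ (algebraMap ℚ K)
  have hsmul : ∀ (q : ℚ) (f : Module.End K A₀), q • f = algebraMap ℚ K q • f := fun _ _ => rfl
  obtain ⟨n, rfl⟩ : ∃ n, m = n + 1 := ⟨m - 1, by omega⟩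
  set f : ℕ → Module.End K A₀ := S.opCoeff F.toLinearMap with hf
  set g : ℕ → Module.End K A₀ := S.opCoeff F.symm.toLinearMap with hg
  have hFG : F.symm.toLinearMap ∘ₗ F.toLinearMap = LinearMap.id := by ext x; simp
  have hf0 : f 0 = 1 := congrArg AlgHom.toLinearMap hF
  have hgf (m) : ∑ p ∈ antidiagonal m, g p.1 * f p.2 = S.opCoeff LinearMap.id m := by
    rw [← hFG, S.opCoeff_comp]
  have hg0 : g 0 = 1 := by
    have := hgf 0
    simpa [hf0, S.opCoeff_id_zero] using this
  have hgf_succ (n) : ∑ p ∈ antidiagonal (n + 1), g p.1 * f p.2 = 0 := by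
    rw [hgf, S.opCoeff_id_succ]
  have hrec (n : ℕ) : ((n + 1 : ℕ) : ℚ) • g (n + 1) =
      ∑ p ∈ antidiagonal n, g p.2 * ψ (p.1 + 1) := by
    have h1 : ∀ k, ψ (k + 1) = S.opCoeff h k := fun k => LinearMap.ext fun a => hψ _ a
    simp only [h1]
    rw [← Nat.sum_antidiagonal_swap]
    simp only [Prod.fst_swap, Prod.snd_swap]
    rw [← S.opCoeff_comp, hsmul, map_natCast, Nat.cast_smul_eq_nsmul]
    ext a
    -- A constant series is killed by $\partial_t$, so only the conjugated term of $h$ remains: this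
    -- is $G'=Gh$.
    have h2 : F.symm (h (S.incl a)) = S.dt (F.symm (S.incl a)) := by
      rw [hh, S.conjDt_apply, S.dt_incl, sub_zero, AlgEquiv.symm_apply_apply]
    change (n + 1) • S.coeff (n + 1) (F.symm (S.incl a)) = S.coeff n (F.symm (h (S.incl a)))
    rw [h2, S.coeff_dt]
  have hmain := CompositionCoeff.sum_c_smul hg0 hf0 hrec hgf_succ n
  have hfz1 : f 1 z = -H := by
    change S.coeff (0 + 1) (F (S.incl z)) = -H
    rw [hz, map_sub, S.coeff_succ_incl, S.coeff_succ_X_smul, S.coeff_zero_incl, zero_sub]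
  have hfz2 (k : ℕ) : f (k + 2) z = 0 := by
    change S.coeff (k + 1 + 1) (F (S.incl z)) = 0
    rw [hz, map_sub, S.coeff_succ_incl, S.coeff_succ_X_smul, S.coeff_succ_incl, sub_zero]
  -- Used with two weights: $w=1$ for the coefficients of $GF$, and $w(k)=k$ for those of $tG'F$.
  have hsum : ∀ (n : ℕ) (w : ℕ → K),
      ∑ p ∈ antidiagonal (n + 1), w p.1 • g p.1 (f p.2 z) =
        w (n + 1) • g (n + 1) z - w n • g n H := by
    intro n w
    rw [Nat.sum_antidiagonal_succ', hf0]
    cases n with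
    | zero => simp [hfz1, sub_eq_add_neg]
    | succ n =>
      rw [Nat.sum_antidiagonal_succ']
      simp only [add_assoc, one_add_one_eq_two, zero_add, hfz1, hfz2]
      simp [sub_eq_add_neg]
  have hgz (n) : g (n + 1) z = g n H := by
    have h1 := hsum n fun _ => 1
    have h2 := LinearMap.congr_fun (hgf_succ n) z
    rw [LinearMap.sum_apply] at h2
    simp only [one_smul] at h1
    exact sub_eq_zero.1 (h1.symm.trans h2)
  have happ := LinearMap.congr_fun hmain z
  simp only [LinearMap.sum_apply, hsmul, LinearMap.smul_apply] at happ
  rw [happ]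
  change g (n + 1) z = _
  have h3 := hsum n fun k => algebraMap ℚ K k
  rw [Nat.sum_antidiagonal_succ] at h3
  simp only [Nat.cast_zero, map_zero, zero_smul, zero_add] at h3
  refine Eq.trans ?_ h3.symm
  -- Both terms are multiples of $g_{n+1}z$, with total factor $(n+1)-n=1$.
  rw [← hgz, ← sub_smul, ← map_sub]
  simp

end Automorphism

end ParameterAlgebra

/-! ### Noncommuting variables: maps determined by the variables. -/

namespace NCPowerSeries

variable {n : ℕ} {R : Type*} [CommRing R]

theorem tail_X (i j : Fin n) : tail j (X i : NCPowerSeries (Fin n) R) = if j = i then 1 else 0 := by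
  ext w
  rw [coeff_tail, coeff_X]
  by_cases hj : j = i
  · subst hj
    cases w with
    | nil => simp only [if_true]; rfl
    | cons b w => simp only [if_true]; simp; rfl
  · simp [hj]

theorem coeff_nil_X (i : Fin n) : coeff [] (X i : NCPowerSeries (Fin n) R) = 0 := by
  simp [coeff_X]

theorem coeff_cons_X_mul (a i : Fin n) (w : List (Fin n)) (f : NCPowerSeries (Fin n) R) :
    coeff (a :: w) (X i * f) = if a = i then coeff w f else 0 := by
  rw [coeff_mul_cons, coeff_nil_X, tail_X, zero_mul, zero_add]
  split_ifs <;> simp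

theorem coeff_nil_sum_X_mul (f : Fin n → NCPowerSeries (Fin n) R) :
    coeff [] (∑ i, X i * f i) = 0 := by
  simp [coeff_mul_nil, coeff_nil_X]

theorem coeff_cons_sum_X_mul (a : Fin n) (w : List (Fin n)) (f : Fin n → NCPowerSeries (Fin n) R) :
    coeff (a :: w) (∑ i, X i * f i) = coeff w (f a) := by
  simp [coeff_cons_X_mul]

theorem eq_algebraMap_add_sum_X_mul_tail (f : NCPowerSeries (Fin n) R) :
    f = algebraMap R _ (coeff [] f) + ∑ i, X i * tail i f := by
  ext w
  rw [map_add]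
  cases w with
  | nil => rw [coeff_nil_sum_X_mul, add_zero]; rfl
  | cons a w =>
    rw [coeff_cons_sum_X_mul, coeff_tail]
    exact (zero_add _).symm

/-- Splitting off the first letter gives $Df=\sum_i z_i\,D(\partial_if)$, so each coefficient
vanishes by induction on the word. This replaces continuity in the uniqueness statements below,
where `D` is a difference of two maps. -/
theorem addMonoidHom_eq_zero {D : NCPowerSeries (Fin n) R →+ NCPowerSeries (Fin n) R}
    (h : ∀ r, D (algebraMap R _ r) = 0) (hX : ∀ i f, D (X i * f) = X i * D f) : D = 0 := by
  have key : ∀ f, D f = ∑ i, X i * D (tail i f) := by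
    intro f
    conv_lhs => rw [eq_algebraMap_add_sum_X_mul_tail f]
    rw [map_add, h, zero_add, map_sum]
    simp only [hX]
  refine AddMonoidHom.ext fun f => ext fun w => ?_
  induction w generalizing f with
  | nil => rw [key, coeff_nil_sum_X_mul]; rfl
  | cons a w ih => rw [key, coeff_cons_sum_X_mul, ih]; rfl

/-- Algebra endomorphisms that fix the variables are trivial. -/
theorem algHom_eq_id (φ : NCPowerSeries (Fin n) R →ₐ[R] NCPowerSeries (Fin n) R)
    (h : ∀ i, φ (X i) = X i) : φ = AlgHom.id R _ := by
  have hD : φ.toRingHom.toAddMonoidHom - AddMonoidHom.id _ = 0 := by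
    refine addMonoidHom_eq_zero (fun r => ?_) fun i f => ?_
    · exact sub_eq_zero.2 (φ.commutes r)
    · change φ (X i * f) - X i * f = X i * (φ f - f)
      rw [map_mul, h, mul_sub]
  exact AlgHom.ext fun f => sub_eq_zero.1 (DFunLike.congr_fun hD f)

/-- Derivations that agree on the variables are equal. -/
theorem linearMap_ext_of_leibniz {D E : NCPowerSeries (Fin n) R →ₗ[R] NCPowerSeries (Fin n) R}
    (hD : ∀ f g, D (f * g) = D f * g + f * D g) (hE : ∀ f g, E (f * g) = E f * g + f * E g)
    (h : ∀ i, D (X i) = E (X i)) : D = E := by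
  have one : ∀ {D : NCPowerSeries (Fin n) R →ₗ[R] NCPowerSeries (Fin n) R},
      (∀ f g, D (f * g) = D f * g + f * D g) → ∀ r : R, D (algebraMap R _ r) = 0 := by
    intro D hD r
    have := hD 1 1
    rw [mul_one, mul_one, one_mul, left_eq_add] at this
    rw [Algebra.algebraMap_eq_smul_one, map_smul, this, smul_zero]
  have h0 : (D - E).toAddMonoidHom = 0 := by
    refine addMonoidHom_eq_zero (fun r => ?_) fun i f => ?_
    · exact sub_eq_zero.2 ((one hD r).trans (one hE r).symm)
    · change D (X i * f) - E (X i * f) = X i * (D f - E f)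
      rw [hD, hE, h]
      noncomm_ring
  exact LinearMap.ext fun f => sub_eq_zero.1 (DFunLike.congr_fun h0 f)

end NCPowerSeries

/-! ### Noncommuting variables: the inversion formula. -/

namespace NCSeries

open NCPowerSeries

variable {n : ℕ} {K : Type*} [CommRing K]

/-- `K[[t]]⟨⟨z⟩⟩` as the power series in `t` over `K⟨⟨z⟩⟩`. -/
def parameterAlgebra (n : ℕ) (K : Type*) [CommRing K] :
    ParameterAlgebra K (NCPowerSeries (Fin n) K) (NCPowerSeries (Fin n) K⟦X⟧) where
  coeff k :=
    { toFun := tCoeff k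
      map_zero' := funext fun w => by exact map_zero (PowerSeries.coeff k)
      map_add' := fun f g => funext fun w => by exact map_add (PowerSeries.coeff k) _ _ }
  incl :=
    { toFun := incl
      map_zero' := funext fun w => by exact map_zero PowerSeries.C
      map_one' := funext fun w => by
        cases w
        · exact map_one PowerSeries.C
        · exact map_zero PowerSeries.C
      map_add' := fun f g => funext fun w => by exact map_add PowerSeries.C _ _
      map_mul' := fun f g => funext fun w => by
        change PowerSeries.C (NCPowerSeries.coeff w (f * g)) =
          NCPowerSeries.coeff w (incl f * incl g)
        rw [coeff_mul, coeff_mul, map_sum]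
        exact sum_congr rfl fun i _ => map_mul PowerSeries.C _ _ }
  dt :=
    { toFun := dt
      map_zero' := funext fun w => by exact map_zero (PowerSeries.derivative (R := K))
      map_add' := fun f g => funext fun w => by
        exact map_add (PowerSeries.derivative (R := K)) _ _ }
  ext := fun H => funext fun w => PowerSeries.ext fun k => congrFun (H k) w
  coeff_zero_incl a := funext fun w => by exact PowerSeries.coeff_zero_C _
  coeff_succ_incl k a := funext fun w => by exact PowerSeries.coeff_succ_C
  incl_smul r a := funext fun w => by exact map_mul PowerSeries.C _ _
  coeff_C_smul k r x := funext fun w => by exact PowerSeries.coeff_C_mul _ _ _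
  coeff_zero_X_smul x := funext fun w => by exact PowerSeries.coeff_zero_X_mul _
  coeff_succ_X_smul k x := funext fun w => by exact PowerSeries.coeff_succ_X_mul _ _
  exists_eq_add x := by
    refine ⟨fun w => PowerSeries.mk fun k => PowerSeries.coeff (k + 1) (x w), funext fun w => ?_⟩
    change x w = PowerSeries.C (PowerSeries.coeff 0 (x w)) +
      PowerSeries.X * PowerSeries.mk fun k => PowerSeries.coeff (k + 1) (x w)
    rw [PowerSeries.coeff_zero_eq_constantCoeff_apply, add_comm]
    exact PowerSeries.eq_X_mul_shift_add_const (x w)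
  coeff_zero_mul x y := funext fun w => by
    change PowerSeries.coeff 0 (NCPowerSeries.coeff w (x * y)) =
      NCPowerSeries.coeff w (tCoeff 0 x * tCoeff 0 y)
    rw [coeff_mul, coeff_mul, map_sum]
    exact sum_congr rfl fun i _ => (PowerSeries.coeff_mul 0 _ _).trans (sum_singleton _ _)
  coeff_dt k x := funext fun w => by
    refine (PowerSeries.coeff_derivative _ _).trans ?_
    change _ = (k + 1) • PowerSeries.coeff (k + 1) (x w)
    rw [nsmul_eq_mul, mul_comm]
    push_cast
    rfl
  dt_mul x y := funext fun w => by
    change PowerSeries.derivative (R := K) (NCPowerSeries.coeff w (x * y)) =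
      NCPowerSeries.coeff w (dt x * y) + NCPowerSeries.coeff w (x * dt y)
    rw [coeff_mul, coeff_mul, coeff_mul, map_sum, ← sum_add_distrib]
    refine sum_congr rfl fun i _ => (Derivation.leibniz _ _ _).trans ?_
    simp only [smul_eq_mul]
    rw [add_comm, mul_comm (NCPowerSeries.coeff _ y)]
    rfl
  dt_smul r x := funext fun w => by
    change PowerSeries.derivative (R := K) (r * NCPowerSeries.coeff w x) =
      PowerSeries.derivative (R := K) r * NCPowerSeries.coeff w x +
        r * PowerSeries.derivative (R := K) (NCPowerSeries.coeff w x)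
    rw [Derivation.leibniz, add_comm, smul_eq_mul, smul_eq_mul, mul_comm (NCPowerSeries.coeff w x)]

theorem incl_X (i : Fin n) : incl (X i : NCPowerSeries (Fin n) K) = X i := by
  funext w
  change PowerSeries.C (if _ then _ else _) = if _ then _ else _
  split_ifs <;> simp

variable {F : NCPowerSeries (Fin n) K⟦X⟧ ≃ₐ[K⟦X⟧] NCPowerSeries (Fin n) K⟦X⟧}
  {H : Fin n → NCPowerSeries (Fin n) K}

theorem constHom_eq_id (hF : ∀ i, F (X i) = X i - (PowerSeries.X : K⟦X⟧) • incl (H i)) :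
    (parameterAlgebra n K).constHom F = AlgHom.id K _ := by
  refine algHom_eq_id _ fun i => ?_
  change (parameterAlgebra n K).coeff 0 (F (incl (X i))) = X i
  rw [incl_X, hF, map_sub, ParameterAlgebra.coeff_zero_X_smul, sub_zero, ← incl_X]
  exact (parameterAlgebra n K).coeff_zero_incl _

theorem h_eq_conjDt : h F = (parameterAlgebra n K).conjDt F := by
  refine linearMap_ext_of_leibniz (deriv_mul _) ((parameterAlgebra n K).conjDt_mul F) fun i => ?_
  have hX : (parameterAlgebra n K).dt (X i) = 0 := by
    rw [← incl_X]
    exact (parameterAlgebra n K).dt_incl _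
  -- The variables are free of $t$, hence $\partial_tG_t=\partial_tM_t$, and the two derivations
  -- agree on them.
  have e : F.symm (X i) = X i + Mt F i := by rw [Mt]; abel
  rw [h, deriv_X, ParameterAlgebra.conjDt_apply, hX, e, map_add, hX, zero_add, sub_zero]
  rfl

theorem N_eq_sum [Algebra ℚ K]
    (hF : ∀ i, F (X i) = X i - (PowerSeries.X : K⟦X⟧) • incl (H i))
    {m : ℕ} (hm : 1 ≤ m) (i : Fin n) :
    N F m i = ∑ I : Composition m,
      algebraMap ℚ K (CompositionCoeff.c I) • psiPow F I (X i) := by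
  have key := (parameterAlgebra n K).coeff_symm_eq_sum (constHom_eq_id hF)
    (fun x => LinearMap.congr_fun h_eq_conjDt x) (ψ := psi F) (fun _ _ => rfl)
    (z := X i) (H := H i) ((congrArg F (incl_X i)).trans ((hF i).trans (by rw [← incl_X]; rfl))) hm
  refine Eq.trans ?_ key
  obtain ⟨k, rfl⟩ : ∃ k, m = k + 1 := ⟨m - 1, by omega⟩
  -- In positive degree in $t$ the summand $z$ of $G_t=z+M_t$ does not contribute.
  change (parameterAlgebra n K).coeff (k + 1) (F.symm (X i) - X i) =
    (parameterAlgebra n K).coeff (k + 1) (F.symm (incl (X i)))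
  rw [map_sub, incl_X, sub_eq_self, ← incl_X]
  exact (parameterAlgebra n K).coeff_succ_incl _ _

end NCSeries

/-! ### Commuting variables: maps determined by the variables, and the inversion formula. -/

namespace CommSeries

section Uniqueness

variable {n : ℕ} {R : Type*} [CommRing R]

/-- The commuting substitute for removing the first letter: each nonconstant monomial is assigned to
its variable of smallest index, so that it is counted once. -/
theorem exists_eq_algebraMap_add_sum_X_mul (f : MvPowerSeries (Fin n) R) :
    ∃ (r : R) (g : Fin n → MvPowerSeries (Fin n) R),
      f = algebraMap R _ r + ∑ i, MvPowerSeries.X i * g i := by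
  classical
  obtain ⟨g, hg⟩ : ∃ g : Fin n → MvPowerSeries (Fin n) R, ∀ i b, MvPowerSeries.coeff b (g i) =
      if ∀ j < i, b j = 0 then MvPowerSeries.coeff (b + Finsupp.single i 1) f else 0 :=
    ⟨fun i b => if ∀ j < i, b j = 0 then MvPowerSeries.coeff (b + Finsupp.single i 1) f else 0,
      fun _ _ => rfl⟩
  refine ⟨MvPowerSeries.constantCoeff f, g, ?_⟩
  ext a
  rw [map_add, map_sum, MvPowerSeries.algebraMap_apply, Algebra.algebraMap_self, RingHom.id_apply,
    MvPowerSeries.coeff_C]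
  simp only [MvPowerSeries.X, MvPowerSeries.coeff_monomial_mul, one_mul]
  split_ifs with ha
  · subst ha
    simp
  · have hne : a.support.Nonempty := Finsupp.support_nonempty_iff.2 ha
    set i := a.support.min' hne with hi
    have hai : a i ≠ 0 := Finsupp.mem_support_iff.1 (a.support.min'_mem hne)
    have hmin : ∀ j < i, a j = 0 := fun j hj => by
      by_contra h
      exact absurd (a.support.min'_le j (Finsupp.mem_support_iff.2 h)) (not_le.2 hj)
    have hle : ∀ j, Finsupp.single j 1 ≤ a ↔ a j ≠ 0 := fun j => by
      rw [Finsupp.single_le_iff, Nat.one_le_iff_ne_zero]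
    rw [zero_add, sum_eq_single i]
    · rw [if_pos ((hle i).2 hai)]
      rw [hg, if_pos fun j hj => by rw [Finsupp.tsub_apply, hmin j hj, Nat.zero_sub],
        tsub_add_cancel_of_le ((hle i).2 hai)]
    · intro j _ hj
      split_ifs with h
      · rw [hg, if_neg]
        intro h'
        -- A variable before $z_i$ does not divide the monomial; after division by a later one,
        -- $z_i$ is still present, which the condition on $g_j$ excludes.
        rcases lt_or_gt_of_ne hj with hlt | hgt
        · exact (hle j).1 h (hmin j hlt)
        · have := h' i hgt
          rw [Finsupp.tsub_apply, Finsupp.single_eq_of_ne hj.symm] at this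
          exact hai this
      · rfl
    · simp

/-- Here the induction is on the total degree of the monomial, for all series at once: pulling out a
variable lowers the degree by one. -/
theorem addMonoidHom_eq_zero {D : MvPowerSeries (Fin n) R →+ MvPowerSeries (Fin n) R}
    (h : ∀ r, D (algebraMap R _ r) = 0)
    (hX : ∀ i f, D (MvPowerSeries.X i * f) = MvPowerSeries.X i * D f) : D = 0 := by
  suffices H : ∀ d f a, Finsupp.degree a = d → MvPowerSeries.coeff a (D f) = 0 from
    AddMonoidHom.ext fun f => MvPowerSeries.ext fun a => H _ f a rfl
  intro d
  induction d using Nat.strong_induction_on with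
  | _ d ih =>
    intro f a ha
    obtain ⟨r, g, rfl⟩ := exists_eq_algebraMap_add_sum_X_mul f
    rw [map_add, h, zero_add, map_sum, map_sum]
    refine sum_eq_zero fun i _ => ?_
    rw [hX, MvPowerSeries.X, MvPowerSeries.coeff_monomial_mul, one_mul]
    split_ifs with hi
    · refine ih _ ?_ _ _ rfl
      have := congrArg Finsupp.degree (tsub_add_cancel_of_le hi)
      rw [map_add, Finsupp.degree_single] at this
      omega
    · rfl

/-- Algebra endomorphisms that fix the variables are trivial. -/
theorem algHom_eq_id (φ : MvPowerSeries (Fin n) R →ₐ[R] MvPowerSeries (Fin n) R)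
    (h : ∀ i, φ (MvPowerSeries.X i) = MvPowerSeries.X i) : φ = AlgHom.id R _ := by
  have hD : φ.toRingHom.toAddMonoidHom - AddMonoidHom.id _ = 0 := by
    refine addMonoidHom_eq_zero (fun r => ?_) fun i f => ?_
    · exact sub_eq_zero.2 (φ.commutes r)
    · change φ (MvPowerSeries.X i * f) - MvPowerSeries.X i * f = MvPowerSeries.X i * (φ f - f)
      rw [map_mul, h, mul_sub]
  exact AlgHom.ext fun f => sub_eq_zero.1 (DFunLike.congr_fun hD f)

/-- Derivations that agree on the variables are equal. -/
theorem derivation_ext {D E : Derivation R (MvPowerSeries (Fin n) R) (MvPowerSeries (Fin n) R)}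
    (h : ∀ i, D (MvPowerSeries.X i) = E (MvPowerSeries.X i)) : D = E := by
  have h0 : (D - E).toLinearMap.toAddMonoidHom = 0 := by
    refine addMonoidHom_eq_zero (fun r => (D - E).map_algebraMap r) fun i f => ?_
    have hi : (D - E) (MvPowerSeries.X i) = 0 := sub_eq_zero.2 (h i)
    change (D - E) (MvPowerSeries.X i * f) = MvPowerSeries.X i * (D - E) f
    rw [Derivation.leibniz, hi, smul_zero, add_zero, smul_eq_mul]
  exact Derivation.ext fun f => sub_eq_zero.1 (DFunLike.congr_fun h0 f)

end Uniqueness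

variable {n : ℕ} {K : Type*} [CommRing K]

/-- `K[[t]]⟨⟨z⟩⟩` as the power series in `t` over `K⟨⟨z⟩⟩`. -/
def parameterAlgebra (n : ℕ) (K : Type*) [CommRing K] :
    ParameterAlgebra K (MvPowerSeries (Fin n) K) (MvPowerSeries (Fin n) K⟦X⟧) where
  coeff k :=
    { toFun := tCoeff k
      map_zero' := funext fun w => by exact map_zero (PowerSeries.coeff k)
      map_add' := fun f g => funext fun w => by exact map_add (PowerSeries.coeff k) _ _ }
  incl := MvPowerSeries.map PowerSeries.C
  dt :=
    { toFun := dt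
      map_zero' := funext fun w => by exact map_zero (PowerSeries.derivative (R := K))
      map_add' := fun f g => funext fun w => by
        exact map_add (PowerSeries.derivative (R := K)) _ _ }
  ext := fun H => funext fun w => PowerSeries.ext fun k => congrFun (H k) w
  coeff_zero_incl a := funext fun w => by exact PowerSeries.coeff_zero_C _
  coeff_succ_incl k a := funext fun w => by exact PowerSeries.coeff_succ_C
  incl_smul r a := funext fun w => by exact map_mul PowerSeries.C _ _
  coeff_C_smul k r x := funext fun w => by exact PowerSeries.coeff_C_mul _ _ _
  coeff_zero_X_smul x := funext fun w => by exact PowerSeries.coeff_zero_X_mul _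
  coeff_succ_X_smul k x := funext fun w => by exact PowerSeries.coeff_succ_X_mul _ _
  exists_eq_add x := by
    refine ⟨fun w => PowerSeries.mk fun k => PowerSeries.coeff (k + 1) (x w), funext fun w => ?_⟩
    change x w = PowerSeries.C (PowerSeries.coeff 0 (x w)) +
      PowerSeries.X * PowerSeries.mk fun k => PowerSeries.coeff (k + 1) (x w)
    rw [PowerSeries.coeff_zero_eq_constantCoeff_apply, add_comm]
    exact PowerSeries.eq_X_mul_shift_add_const (x w)
  coeff_zero_mul x y := funext fun w => by
    classical
    change PowerSeries.coeff 0 (MvPowerSeries.coeff w (x * y)) =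
      MvPowerSeries.coeff w (tCoeff 0 x * tCoeff 0 y)
    rw [MvPowerSeries.coeff_mul, MvPowerSeries.coeff_mul, map_sum]
    exact sum_congr rfl fun i _ => (PowerSeries.coeff_mul 0 _ _).trans (sum_singleton _ _)
  coeff_dt k x := funext fun w => by
    refine (PowerSeries.coeff_derivative _ _).trans ?_
    change _ = (k + 1) • PowerSeries.coeff (k + 1) (x w)
    rw [nsmul_eq_mul, mul_comm]
    push_cast
    rfl
  dt_mul x y := funext fun w => by
    classical
    change PowerSeries.derivative (R := K) (MvPowerSeries.coeff w (x * y)) =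
      MvPowerSeries.coeff w (dt x * y) + MvPowerSeries.coeff w (x * dt y)
    rw [MvPowerSeries.coeff_mul, MvPowerSeries.coeff_mul, MvPowerSeries.coeff_mul, map_sum,
      ← sum_add_distrib]
    refine sum_congr rfl fun i _ => (Derivation.leibniz _ _ _).trans ?_
    simp only [smul_eq_mul]
    rw [add_comm, mul_comm (MvPowerSeries.coeff _ y)]
    rfl
  dt_smul r x := funext fun w => by
    change PowerSeries.derivative (R := K) (r * MvPowerSeries.coeff w x) =
      PowerSeries.derivative (R := K) r * MvPowerSeries.coeff w x +
        r * PowerSeries.derivative (R := K) (MvPowerSeries.coeff w x)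
    rw [Derivation.leibniz, add_comm, smul_eq_mul, smul_eq_mul, mul_comm (MvPowerSeries.coeff w x)]

theorem incl_X (i : Fin n) :
    incl (MvPowerSeries.X i : MvPowerSeries (Fin n) K) = MvPowerSeries.X i :=
  MvPowerSeries.map_X _ _

variable {F : MvPowerSeries (Fin n) K⟦X⟧ ≃ₐ[K⟦X⟧] MvPowerSeries (Fin n) K⟦X⟧}
  {H : Fin n → MvPowerSeries (Fin n) K}

theorem constHom_eq_id (hF : ∀ i, F (MvPowerSeries.X i) =
      MvPowerSeries.X i - (PowerSeries.X : K⟦X⟧) • incl (H i)) :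
    (parameterAlgebra n K).constHom F = AlgHom.id K _ := by
  refine algHom_eq_id _ fun i => ?_
  change (parameterAlgebra n K).coeff 0 (F (incl (MvPowerSeries.X i))) = MvPowerSeries.X i
  rw [incl_X, hF, map_sub, ParameterAlgebra.coeff_zero_X_smul, sub_zero, ← incl_X]
  exact (parameterAlgebra n K).coeff_zero_incl _

theorem h_eq_conjDt (f : MvPowerSeries (Fin n) K⟦X⟧) :
    h F f = (parameterAlgebra n K).conjDt F f := by
  let D := Derivation.mk' ((parameterAlgebra n K).conjDt F) fun f g => by
    rw [ParameterAlgebra.conjDt_mul, smul_eq_mul, smul_eq_mul, add_comm, mul_comm g]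
  suffices h F = D from DFunLike.congr_fun this f
  refine derivation_ext fun i => ?_
  change _ = (parameterAlgebra n K).conjDt F (MvPowerSeries.X i)
  have hX : (parameterAlgebra n K).dt (MvPowerSeries.X i) = 0 := by
    rw [← incl_X]
    exact (parameterAlgebra n K).dt_incl _
  have e : F.symm (MvPowerSeries.X i) = MvPowerSeries.X i + Mt F i := by rw [Mt]; abel
  rw [h, deriv_X, ParameterAlgebra.conjDt_apply, hX, e, map_add, hX, zero_add, sub_zero]
  rfl

theorem N_eq_sum [Algebra ℚ K]
    (hF : ∀ i, F (MvPowerSeries.X i) =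
      MvPowerSeries.X i - (PowerSeries.X : K⟦X⟧) • incl (H i))
    {m : ℕ} (hm : 1 ≤ m) (i : Fin n) :
    N F m i = ∑ I : Composition m,
      algebraMap ℚ K (CompositionCoeff.c I) • psiPow F I (MvPowerSeries.X i) := by
  have key := (parameterAlgebra n K).coeff_symm_eq_sum (constHom_eq_id hF)
    (h := (h F).toLinearMap) h_eq_conjDt (ψ := psi F) (fun _ _ => rfl)
    (z := MvPowerSeries.X i) (H := H i)
    ((congrArg F (incl_X i)).trans ((hF i).trans (by rw [← incl_X]; rfl))) hm
  refine Eq.trans ?_ key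
  obtain ⟨k, rfl⟩ : ∃ k, m = k + 1 := ⟨m - 1, by omega⟩
  change (parameterAlgebra n K).coeff (k + 1) (F.symm (MvPowerSeries.X i) - MvPowerSeries.X i) =
    (parameterAlgebra n K).coeff (k + 1) (F.symm (incl (MvPowerSeries.X i)))
  rw [map_sub, incl_X, sub_eq_self, ← incl_X]
  exact (parameterAlgebra n K).coeff_succ_incl _ _

end CommSeries

end

theorem mainTheorem8 (K : Type*) [CommRing K] [Algebra ℚ K] (n α : ℕ) (hα : 1 ≤ α) :
    -- commuting variables `z = (z₁, …, zₙ)`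
    (∀ (H : Fin n → MvPowerSeries (Fin n) K)
      (F : MvPowerSeries (Fin n) (PowerSeries K) ≃ₐ[PowerSeries K]
        MvPowerSeries (Fin n) (PowerSeries K)),
      (∀ i, (α : ℕ∞) ≤ (H i).order) →
      (∀ i, F (MvPowerSeries.X i) =
        MvPowerSeries.X i - (PowerSeries.X : PowerSeries K) • CommSeries.incl (H i)) →
      ∀ m : ℕ, 1 ≤ m → ∀ i : Fin n,
        CommSeries.N F m i = ∑ I : Composition m,
          algebraMap ℚ K (CompositionCoeff.c I) • CommSeries.psiPow F I (MvPowerSeries.X i)) ∧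
    -- noncommuting free variables `z = (z₁, …, zₙ)`
    (∀ (H : Fin n → NCPowerSeries (Fin n) K)
      (F : NCPowerSeries (Fin n) (PowerSeries K) ≃ₐ[PowerSeries K]
        NCPowerSeries (Fin n) (PowerSeries K)),
      (∀ i, NCSeries.LeOrder α (H i)) →
      (∀ i, F (NCPowerSeries.X i) =
        NCPowerSeries.X i - (PowerSeries.X : PowerSeries K) • NCSeries.incl (H i)) →
      ∀ m : ℕ, 1 ≤ m → ∀ i : Fin n,
        NCSeries.N F m i = ∑ I : Composition m,
          algebraMap ℚ K (CompositionCoeff.c I) •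
            NCSeries.psiPow F I (NCPowerSeries.X i)) := by
  refine ⟨fun H F _ hF m hm i => ?_, fun H F _ hF m hm i => ?_⟩
  · exact CommSeries.N_eq_sum hF hm i
  · exact NCSeries.N_eq_sum hF hm i
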